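/- Let $n=2m$ be even. For $X,Y',Y,X'\in\{0,1\}^{m}$ let $$f_n(XY',\,YX') \;=\; \mathrm{IP}(X,Y)\ \wedge\ X=X'\ \wedge\ Y=Y',$$ where $\mathrm{IP}(X,Y)=\sum_i X_iY_i \bmod 2$, Alice's input is the concatenation $x=XY'\in\{0,1\}^n$ and Bob's is $y=YX'\in\{0,1\}^n$. In all the models below the algorithm or the two players have free access to a (shared, possibly infinite) string $r$ of fair random bits. Fix an error bound $0<\varepsilon<1/2$ (for example $\varepsilon=1/3$); to compute $f_n$ means to output $f_n(x,y)$ with probability at least $1-\varepsilon$ on every input; the constants in $O(\cdot)$ and $\Omega(\cdot)$ may depend on $\varepsilon$. (1) $f_n$ can be computed by a one-pass streaming algorithm with $O(\log n)$ bits of memory on the interleaved stream $x_1,y_1,x_2,y_2,\dots,x_n,y_n$, and the worst-case randomized (public-coin) two-party communication complexity of $f_n$ is $O(\log n)$. (2) Consider the streaming communication (SC) model: Alice and Bob each have $S$ bits of memory. In each time slot $i=1,\dots,n+1$ Alice reads $x_i$ and Bob reads $y_i$ (in slot $n+1$ both read an end-of-file symbol); each player sends the other a message, a possibly empty bit string of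 any length, that depends on her memory, the symbol just read and $r$; each player then updates her memory as a function of the message received, her memory, that symbol and $r$. After the exchange in slot $n+1$ the players must output. A protocol uses $R$ rounds if on every input the expected number of time slots in which at least one message is nonempty is at most $R$. Then, when $S=\Omega(\log n)$, every SC protocol that computes $f_n$ satisfies $R\cdot S=\Omega(n)$: for every $c_0>0$ there is $c>0$ such that for all even $n$, every SC protocol for $f_n$ with $S\ge c_0\log n$ bits of memory per player that uses $R$ rounds has $R\cdot S\ge c\,n$. -/

import Mathlib

open scoped ENNReal NNReal

namespace StreamComm

/-! ### Shared randomness -/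

/-- The shared random string: an infinite sequence of bits. -/
abbrev Coins : Type := ℕ → Bool

/-- The law of the shared random string: independent fair coin flips. -/
noncomputable def coinMeasure : MeasureTheory.Measure Coins :=
  MeasureTheory.Measure.infinitePi fun _ : ℕ => (PMF.uniformOfFintype Bool).toMeasure

/-! ### Communication complexity -/

/-- Deterministic two-party communication protocols with Boolean output, as binary trees: at an
inner node the owner of the node sends one bit, which depends on the owner's input (and, through
the position in the tree, on all earlier bits); a leaf carries the common output. -/
inductive CommTree (X Y : Type) : Type
  | leaf (output : Bool) : CommTree X Y
  | alice (bit : X → Bool) (next : Bool → CommTree X Y) : CommTree X Y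
  | bob (bit : Y → Bool) (next : Bool → CommTree X Y) : CommTree X Y

namespace CommTree

variable {X Y : Type}

/-- The output on inputs `x`, `y`. -/
def run : CommTree X Y → X → Y → Bool
  | leaf b, _, _ => b
  | alice q next, x, y => (next (q x)).run x y
  | bob q next, x, y => (next (q y)).run x y

/-- The transcript (the sequence of all exchanged bits) on inputs `x`, `y`. -/
def transcript : CommTree X Y → X → Y → List Bool
  | leaf _, _, _ => []
  | alice q next, x, y => q x :: (next (q x)).transcript x y
  | bob q next, x, y => q y :: (next (q y)).transcript x y

end CommTree

/-- A public-coin communication protocol: a random deterministic protocol. -/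
structure CommProtocol (X Y : Type) where
  tree : Coins → CommTree X Y
  measurable_run : ∀ x y b, MeasurableSet {r : Coins | (tree r).run x y = b}

namespace CommProtocol

variable {X Y : Type}

/-- On every input, the output differs from `f x y` with probability at most `ε`. -/
def Computes (P : CommProtocol X Y) (f : X → Y → Bool) (ε : ℝ) : Prop :=
  ∀ x y, coinMeasure {r | (P.tree r).run x y ≠ f x y} ≤ ENNReal.ofReal ε

/-- The largest length of a transcript, over all inputs and all random strings. -/
noncomputable def cost (P : CommProtocol X Y) : ℕ∞ :=
  ⨆ (x : X) (y : Y) (r : Coins), (((P.tree r).transcript x y).length : ℕ∞)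

end CommProtocol

/-- The worst-case randomized communication complexity of `f` with error `ε`. -/
noncomputable def commComplexity {X Y : Type} (f : X → Y → Bool) (ε : ℝ) : ℕ∞ :=
  ⨅ (P : CommProtocol X Y) (_ : P.Computes f ε), P.cost

/-! ### Streaming algorithms on interleaved streams -/

/-- A memory of `S` bits. -/
abbrev Memory (S : ℕ) : Type := Fin S → Bool

/-- A one-pass randomized streaming algorithm with `S` bits of memory. -/
structure StreamingAlgorithm (S : ℕ) where
  init : Coins → Memory S
  step : Memory S → Bool → Coins → Memory S
  output : Memory S → Coins → Bool
  measurable_init : ∀ s, MeasurableSet {r : Coins | init r = s}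
  measurable_step : ∀ s a s', MeasurableSet {r : Coins | step s a r = s'}
  measurable_output : ∀ s b, MeasurableSet {r : Coins | output s r = b}

/-- The interleaved stream `x₁, y₁, x₂, y₂, …`. -/
def interleave {N : ℕ} (x y : Fin N → Bool) : List Bool :=
  (List.finRange N).flatMap fun i => [x i, y i]

namespace StreamingAlgorithm

variable {S : ℕ}

/-- The output of the algorithm after reading the given stream. -/
def run (A : StreamingAlgorithm S) (stream : List Bool) (r : Coins) : Bool :=
  A.output (stream.foldl (fun s a => A.step s a r) (A.init r)) r

/-- On every input, the output on the interleaved stream differs from `f x y` with probability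
at most `ε`. -/
def ComputesInterleaved {N : ℕ} (A : StreamingAlgorithm S)
    (f : (Fin N → Bool) → (Fin N → Bool) → Bool) (ε : ℝ) : Prop :=
  ∀ x y, coinMeasure {r | A.run (interleave x y) r ≠ f x y} ≤ ENNReal.ofReal ε

end StreamingAlgorithm

/-- The memory (in bits) required to compute `f` with error `ε` by a streaming algorithm when the
two inputs are interleaved in a single stream. -/
noncomputable def interleavedComplexity {N : ℕ}
    (f : (Fin N → Bool) → (Fin N → Bool) → Bool) (ε : ℝ) : ℕ∞ :=
  ⨅ (S : ℕ) (A : StreamingAlgorithm S) (_ : A.ComputesInterleaved f ε), (S : ℕ∞)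

/-! ### Streaming communication protocols -/

/-- The two players. -/
inductive Player : Type
  | alice : Player
  | bob : Player

namespace Player

/-- The other player. -/
def other : Player → Player
  | alice => bob
  | bob => alice

end Player

/-- Messages are bit strings of arbitrary length; the empty string means silence. -/
abbrev Message : Type := List Bool

/-- The symbols of a stream: `some b` is an input bit, `none` is the end-of-file symbol. -/
abbrev StreamSymbol : Type := Option Bool

/-- A streaming communication protocol in which each player has `S` bits of memory.
In every time slot each player reads the next symbol of her stream, sends a message
that depends on her memory, the symbol just read and the randomness, and then updates her memory
from the message received, her memory, that symbol and the randomness. -/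
structure SCProtocol (S : ℕ) where
  init : Player → Coins → Memory S
  send : Player → Memory S → StreamSymbol → Coins → Message
  update : Player → Message → Memory S → StreamSymbol → Coins → Memory S
  output : Player → Message → Memory S → Coins → Bool
  measurable_init : ∀ p s, MeasurableSet {r : Coins | init p r = s}
  measurable_send : ∀ p s a w, MeasurableSet {r : Coins | send p s a r = w}
  measurable_update : ∀ p w s a s', MeasurableSet {r : Coins | update p w s a r = s'}
  measurable_output : ∀ p w s b, MeasurableSet {r : Coins | output p w s r = b}

namespace SCProtocol

variable {S N : ℕ}

/-- The symbol that player `p` reads in time slot `t` (slots are numbered from `0`) when Alice has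
the input `x` and Bob has the input `y`: the input bit number `t` for `t < N`, then end-of-file. -/
def symbolAt (x y : Fin N → Bool) (t : ℕ) (p : Player) : StreamSymbol :=
  if h : t < N then
    match p with
    | .alice => some (x ⟨t, h⟩)
    | .bob => some (y ⟨t, h⟩)
  else none

/-- The memory of the players at the beginning of time slot `t`. -/
def memory (P : SCProtocol S) (x y : Fin N → Bool) (r : Coins) : ℕ → Player → Memory S
  | 0, p => P.init p r
  | t + 1, p =>
      P.update p
        (P.send p.other (memory P x y r t p.other) (symbolAt x y t p.other) r)
        (memory P x y r t p) (symbolAt x y t p) r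

/-- The message that player `p` sends in time slot `t`. -/
def message (P : SCProtocol S) (x y : Fin N → Bool) (r : Coins) (t : ℕ) (p : Player) : Message :=
  P.send p (P.memory x y r t p) (symbolAt x y t p) r

/-- The output of player `p`. After the `N` time slots in which the input bits are read there is
one last round of communication, in which both players read end-of-file; then they output. -/
def result (P : SCProtocol S) (x y : Fin N → Bool) (r : Coins) (p : Player) : Bool :=
  P.output p (P.message x y r N p.other) (P.memory x y r N p) r

open Classical in
/-- The number of communication rounds: the time slots in which some message is nonempty. -/
noncomputable def rounds (P : SCProtocol S) (x y : Fin N → Bool) (r : Coins) : ℕ :=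
  ((Finset.range (N + 1)).filter fun t => ∃ p, P.message x y r t p ≠ []).card

/-- The protocol computes `f` with error `ε`: one of the two players outputs `f x y` with
probability at least `1 - ε` on every input. (Only one player is required to know the value, so
that a lower bound for such protocols also applies when both must know it.) -/
def Computes (P : SCProtocol S) (f : (Fin N → Bool) → (Fin N → Bool) → Bool) (ε : ℝ) : Prop :=
  ∃ p : Player, ∀ x y, coinMeasure {r | P.result x y r p ≠ f x y} ≤ ENNReal.ofReal ε

/-- On every pair of inputs of length `N`, the expected number of rounds is at most `R`. -/
def UsesRounds (P : SCProtocol S) (N : ℕ) (R : ℝ≥0) : Prop :=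
  ∀ x y : Fin N → Bool, ∫⁻ r, (P.rounds x y r : ℝ≥0∞) ∂coinMeasure ≤ R

end SCProtocol

/-! ### The function -/

/-- The inner product modulo 2 of two bit strings. -/
def innerProduct {m : ℕ} (u v : Fin m → Bool) : Bool :=
  decide ((∑ i, (u i && v i).toNat) % 2 = 1)

/-- The first half of a string. -/
def firstHalf {m : ℕ} (z : Fin (m + m) → Bool) : Fin m → Bool := fun i => z (Fin.castAdd m i)

/-- The second half of a string. -/
def secondHalf {m : ℕ} (z : Fin (m + m) → Bool) : Fin m → Bool := fun i => z (Fin.natAdd m i)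

/-- For `x = X Y'` and `y = Y X'`, the value `IP(X, Y) ∧ X = X' ∧ Y = Y'`. -/
def ipEq (m : ℕ) (x y : Fin (m + m) → Bool) : Bool :=
  innerProduct (firstHalf x) (firstHalf y) &&
    decide (firstHalf x = secondHalf y) && decide (firstHalf y = secondHalf x)

end StreamComm

/-! Lower bound. The inputs `x = uv`, `y = vu` satisfy both equality tests, so on them a protocol
must compute `IP(u, v)`. For fixed coins, record the messages of all slots, both memories after slot
`m`, and the output. The inputs sharing a record form a rectangle in `(u, v)`
(`SCProtocol.SameTranscript.mixed`): on `uv'`, `v'u` Alice follows the execution of `(u, v)` while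
she reads `u`, and Bob that of `(u', v')` while he reads `v'`; halfway they exchange executions,
which is consistent because the recorded memories agree. By Lindsey's lemma each rectangle
contributes at most `√(8 ^ m)` to the correlation with IP, whereas an advantage over guessing
requires order `4 ^ m`; hence at least of order `2 ^ (m / 2)` records must occur.

Records are few when rounds are few. For fixed coins a message is a function of memory and symbol,
so it has at most `3 * 2 ^ S` values, whatever its length, and a record with `T` nonempty slots
costs about `T (log n + S) + S` bits. Markov's inequality replaces the expected number of rounds by
a cutoff `T = O(R)`. The term outside `T` is absorbed because `R` is bounded below by a positive
constant: a silent player cannot tell apart two inputs of the other player.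

Upper bounds. The two equalities together say that `x` equals `y` with its halves exchanged, and `k
= O(1)` random parities test this with error `2 ^ (-k)` (`measure_paritiesAgree_le`). On the
interleaved stream the parities and the inner product are updated pair by pair, and only the
position counter grows with `n`. In the two-party model Alice evaluates the inner product alone from
`X` and `Y'`. -/

namespace StreamComm

/-! ### The discrepancy of the inner product -/

section Discrepancy

variable {m : ℕ}

/-- The sign `(-1) ^ IP(u, v)`. -/
def ipSign (u v : Fin m → Bool) : ℝ := ∏ i, if u i && v i then -1 else 1

lemma ipSign_eq (u v : Fin m → Bool) :
    ipSign u v = if innerProduct u v then -1 else 1 := by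
  have h : ipSign u v = (-1) ^ ∑ i, (u i && v i).toNat := by
    rw [← Finset.prod_pow_eq_pow_sum]
    refine Finset.prod_congr rfl fun i _ => ?_
    cases u i && v i <;> simp
  rw [h, innerProduct]
  rcases Nat.even_or_odd (∑ i, (u i && v i).toNat) with h' | h'
  · rw [h'.neg_one_pow, if_neg]
    simp [Nat.even_iff.1 h']
  · rw [h'.neg_one_pow, if_pos]
    simp [Nat.odd_iff.1 h']

/-- Orthogonality of the columns of a Hadamard matrix: the sum factors over coordinates, and a
coordinate where `v` and `w` differ contributes the factor `0`. -/
lemma sum_ipSign_mul_ipSign (v w : Fin m → Bool) :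
    ∑ u, ipSign u v * ipSign u w = if v = w then 2 ^ m else 0 := by
  have h : ∀ u : Fin m → Bool, ipSign u v * ipSign u w =
      ∏ i, ((if u i && v i then (-1 : ℝ) else 1) * if u i && w i then -1 else 1) :=
    fun u => Finset.prod_mul_distrib.symm
  simp_rw [h]
  have := Finset.prod_univ_sum (fun _ : Fin m => (Finset.univ : Finset Bool))
    (fun i b => ((if b && v i then (-1 : ℝ) else 1) * if b && w i then -1 else 1))
  rw [Fintype.piFinset_univ] at this
  rw [← this]
  have h2 : ∀ i, (∑ b : Bool, ((if b && v i then (-1 : ℝ) else 1) * if b && w i then -1 else 1)) =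
      if v i = w i then 2 else 0 := by
    intro i
    cases v i <;> cases w i <;> norm_num
  simp_rw [h2]
  split_ifs with hvw
  · simp [hvw]
  · obtain ⟨i, hi⟩ := Function.ne_iff.1 hvw
    exact Finset.prod_eq_zero (Finset.mem_univ i) (by simp [hi])

/-- Cauchy–Schwarz over the rows in `A`; the sum of squares is then enlarged to all rows, where
orthogonality evaluates it exactly. -/
lemma sq_sum_ipSign_le (A B : Finset (Fin m → Bool)) :
    (∑ u ∈ A, ∑ v ∈ B, ipSign u v) ^ 2 ≤ 8 ^ m := by
  have hA : (A.card : ℝ) ≤ 2 ^ m := by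
    have := A.card_le_univ
    simp only [Fintype.card_fun, Fintype.card_bool, Fintype.card_fin] at this
    exact_mod_cast this
  have hB : (B.card : ℝ) ≤ 2 ^ m := by
    have := B.card_le_univ
    simp only [Fintype.card_fun, Fintype.card_bool, Fintype.card_fin] at this
    exact_mod_cast this
  have h1 : ∑ u, (∑ v ∈ B, ipSign u v) ^ 2 = 2 ^ m * B.card := by
    calc ∑ u, (∑ v ∈ B, ipSign u v) ^ 2
        = ∑ v ∈ B, ∑ w ∈ B, ∑ u, ipSign u v * ipSign u w := by
          simp_rw [sq, Finset.sum_mul_sum]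
          rw [Finset.sum_comm]
          exact Finset.sum_congr rfl fun v _ => Finset.sum_comm
      _ = 2 ^ m * B.card := by
          simp_rw [sum_ipSign_mul_ipSign]
          rw [Finset.sum_congr rfl (g := fun _ => (2 : ℝ) ^ m)]
          · simp [mul_comm]
          · intro v hv
            rw [Finset.sum_ite_eq, if_pos hv]
  calc (∑ u ∈ A, ∑ v ∈ B, ipSign u v) ^ 2
      ≤ A.card * ∑ u ∈ A, (∑ v ∈ B, ipSign u v) ^ 2 := sq_sum_le_card_mul_sum_sq
    _ ≤ A.card * ∑ u, (∑ v ∈ B, ipSign u v) ^ 2 := by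
        gcongr
        exact Finset.subset_univ A
    _ ≤ 2 ^ m * (2 ^ m * 2 ^ m) := by rw [h1]; gcongr
    _ = 8 ^ m := by rw [← mul_pow, ← mul_pow]; norm_num

/-- Lindsey's lemma for the inner product. -/
lemma abs_sum_ipSign_le (A B : Finset (Fin m → Bool)) :
    |∑ u ∈ A, ∑ v ∈ B, ipSign u v| ≤ √(8 ^ m) :=
  Real.abs_le_sqrt (sq_sum_ipSign_le A B)

/-- A labelling whose fibres are rectangles, and on whose fibres the output is constant, has small
correlation with the inner product unless it has many labels. -/
lemma sum_sign_mul_ipSign_le {β : Type*} [DecidableEq β]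
    (τ : (Fin m → Bool) × (Fin m → Bool) → β) (out : (Fin m → Bool) × (Fin m → Bool) → Bool)
    (G : Finset ((Fin m → Bool) × (Fin m → Bool))) (L : Finset β)
    (hL : ∀ p ∈ G, τ p ∈ L)
    (hrect : ∀ p ∈ G, ∀ q ∈ G, τ p = τ q → (p.1, q.2) ∈ G ∧ τ (p.1, q.2) = τ p)
    (hout : ∀ p ∈ G, ∀ q ∈ G, τ p = τ q → out p = out q) :
    ∑ p ∈ G, (if out p then -1 else 1) * ipSign p.1 p.2 ≤ L.card * √(8 ^ m) := by
  rw [← Finset.sum_fiberwise_of_maps_to hL, ← nsmul_eq_mul]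
  refine Finset.sum_le_card_nsmul _ _ _ fun b _ => ?_
  set F := G.filter fun p => τ p = b with hF
  rcases F.eq_empty_or_nonempty with h | ⟨p₀, hp₀⟩
  · rw [h]; simp
  have hmem : ∀ p ∈ F, p ∈ G ∧ τ p = b := fun p hp => Finset.mem_filter.1 hp
  -- Closure under mixing makes the fibre the product of its two projections, the form to which
  -- Lindsey's lemma applies.
  have hFprod : F = F.image Prod.fst ×ˢ F.image Prod.snd := by
    ext ⟨u, v⟩
    simp only [Finset.mem_product, Finset.mem_image]
    constructor
    · intro h
      exact ⟨⟨_, h, rfl⟩, ⟨_, h, rfl⟩⟩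
    · rintro ⟨⟨p, hp, rfl⟩, ⟨q, hq, rfl⟩⟩
      obtain ⟨hp1, hp2⟩ := hmem p hp
      obtain ⟨hq1, hq2⟩ := hmem q hq
      obtain ⟨h1, h2⟩ := hrect p hp1 q hq1 (hp2.trans hq2.symm)
      exact Finset.mem_filter.2 ⟨h1, h2.trans hp2⟩
  have hsum : ∑ p ∈ F, (if out p then (-1 : ℝ) else 1) * ipSign p.1 p.2 =
      (if out p₀ then (-1 : ℝ) else 1) *
        ∑ u ∈ F.image Prod.fst, ∑ v ∈ F.image Prod.snd, ipSign u v := by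
    rw [← Finset.sum_product', ← hFprod, Finset.mul_sum]
    refine Finset.sum_congr rfl fun p hp => ?_
    rw [hout p (hmem p hp).1 p₀ (hmem p₀ hp₀).1 ((hmem p hp).2.trans (hmem p₀ hp₀).2.symm)]
  rw [hsum]
  refine (le_abs_self _).trans ?_
  rw [abs_mul]
  have : |(if out p₀ then (-1 : ℝ) else 1)| = 1 := by split_ifs <;> simp
  rw [this, one_mul]
  exact abs_sum_ipSign_le _ _

end Discrepancy

/-! ### Counting sparse functions -/

/-- Functions on `N` points with values in `K` that take a value other than `d` at most `T` times
form a set of size at most `(N * |K| + 1) ^ T`. -/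
lemma exists_finset_sparse {M : Type*} [DecidableEq M] {N : ℕ} (K : Finset M) (d : M) (T : ℕ) :
    ∃ F : Finset (Fin N → M), F.card ≤ (N * K.card + 1) ^ T ∧
      ∀ f : Fin N → M, (∀ t, f t ∈ K) → (Finset.univ.filter fun t => f t ≠ d).card ≤ T →
        f ∈ F := by
  -- The induction resets a value to `d`, which need not lie in `K`, so the range condition is
  -- relaxed to allow `d`.
  suffices H : ∃ F : Finset (Fin N → M), F.card ≤ (N * K.card + 1) ^ T ∧
      ∀ f : Fin N → M, (∀ t, f t = d ∨ f t ∈ K) →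
        (Finset.univ.filter fun t => f t ≠ d).card ≤ T → f ∈ F by
    obtain ⟨F, h1, h2⟩ := H
    exact ⟨F, h1, fun f hf => h2 f fun t => Or.inr (hf t)⟩
  induction T with
  | zero =>
    refine ⟨{fun _ => d}, by simp, fun f _ hf => ?_⟩
    rw [Finset.mem_singleton]
    ext t
    by_contra hne
    have : t ∈ Finset.univ.filter fun t => f t ≠ d := by simpa using hne
    rw [Nat.le_zero, Finset.card_eq_zero] at hf
    simp [hf] at this
  | succ T ih =>
    obtain ⟨F, hF, hmem⟩ := ih
    refine ⟨((F ×ˢ (Finset.univ : Finset (Fin N)) ×ˢ K).image fun a =>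
      Function.update a.1 a.2.1 a.2.2) ∪ F, ?_, fun f hfK hf => ?_⟩
    · refine (Finset.card_union_le _ _).trans ?_
      refine (add_le_add_left Finset.card_image_le _).trans ?_
      simp only [Finset.card_product, Finset.card_univ, Fintype.card_fin]
      rw [pow_succ, mul_add, mul_one]
      gcongr
    · rcases (Finset.univ.filter fun t => f t ≠ d).eq_empty_or_nonempty with he | ⟨t, ht⟩
      · refine Finset.mem_union_right _ (hmem f hfK ?_)
        simp [he]
      · refine Finset.mem_union_left _ (Finset.mem_image.2
          ⟨(Function.update f t d, t, f t), ?_, by simp⟩)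
        have htd : f t ≠ d := by simpa using ht
        simp only [Finset.mem_product, Finset.mem_univ, true_and]
        refine ⟨hmem _ (fun s => ?_) ?_, (hfK t).resolve_left htd⟩
        · by_cases h : s = t
          · subst h; simp
          · simpa [Function.update_of_ne h] using hfK s
        · have : (Finset.univ.filter fun s => Function.update f t d s ≠ d) =
              (Finset.univ.filter fun s => f s ≠ d).erase t := by
            ext s
            by_cases h : s = t
            · subst h; simp
            · simp [h]
          rw [this, Finset.card_erase_of_mem ht]
          omega

/-! ### Transcripts of streaming communication protocols -/

namespace SCProtocol

variable {S N m : ℕ}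

lemma message_congr (P : SCProtocol S) (r : Coins) {x y x₁ y₁ : Fin N → Bool} {t : ℕ} {p : Player}
    (hmem : P.memory x y r t p = P.memory x₁ y₁ r t p)
    (hsym : symbolAt x y t p = symbolAt x₁ y₁ t p) :
    P.message x y r t p = P.message x₁ y₁ r t p := by
  rw [message, message, hmem, hsym]

lemma memory_succ (P : SCProtocol S) (r : Coins) (x y : Fin N → Bool) (t : ℕ) (p : Player) :
    P.memory x y r (t + 1) p =
      P.update p (P.message x y r t p.other) (P.memory x y r t p) (symbolAt x y t p) r := rfl

lemma _root_.StreamComm.Player.other_other (p : Player) : p.other.other = p := by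
  cases p <;> rfl

lemma _root_.StreamComm.Player.eq_or_eq_other (p q : Player) : q = p ∨ q = p.other := by
  cases p <;> cases q <;> simp [Player.other]

/-- If, at the start of a time slot, one player is in the situation of a first execution and the
other player is in the situation of a second execution, and the two executions exchange the same
messages in this slot, then so does the mixed execution, and the situation persists. -/
lemma mixed_step (P : SCProtocol S) (r : Coins) {x y x₁ y₁ x₂ y₂ : Fin N → Bool} {t : ℕ}
    (p : Player)
    (hmem₁ : P.memory x y r t p = P.memory x₁ y₁ r t p)
    (hmem₂ : P.memory x y r t p.other = P.memory x₂ y₂ r t p.other)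
    (hsym₁ : symbolAt x y t p = symbolAt x₁ y₁ t p)
    (hsym₂ : symbolAt x y t p.other = symbolAt x₂ y₂ t p.other)
    (hmsg : ∀ q, P.message x₁ y₁ r t q = P.message x₂ y₂ r t q) :
    (∀ q, P.message x y r t q = P.message x₁ y₁ r t q) ∧
      P.memory x y r (t + 1) p = P.memory x₁ y₁ r (t + 1) p ∧
      P.memory x y r (t + 1) p.other = P.memory x₂ y₂ r (t + 1) p.other := by
  have h1 := P.message_congr r hmem₁ hsym₁
  have h2 := P.message_congr r hmem₂ hsym₂
  refine ⟨fun q => ?_, ?_, ?_⟩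
  · rcases p.eq_or_eq_other q with rfl | rfl
    · exact h1
    · exact h2.trans (hmsg _).symm
  · rw [memory_succ, memory_succ, hmem₁, hsym₁, h2, hmsg]
  · rw [memory_succ, memory_succ, hmem₂, hsym₂, Player.other_other, h1, hmsg]

/-- With the inputs `u v'` and `v' u`, the players read the first halves of the encodings `u v`,
`v u` and `u' v'`, `v' u'` of two instances of the inner product; then they swap roles. -/
lemma symbolAt_append_of_lt (u v u' v' : Fin m → Bool) {t : ℕ} (ht : t < m) :
    symbolAt (Fin.append u v') (Fin.append v' u) t .alice =
        symbolAt (Fin.append u v) (Fin.append v u) t .alice ∧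
      symbolAt (Fin.append u v') (Fin.append v' u) t .bob =
        symbolAt (Fin.append u' v') (Fin.append v' u') t .bob := by
  have h : t < m + m := by omega
  have e : (⟨t, h⟩ : Fin (m + m)) = Fin.castAdd m ⟨t, ht⟩ := rfl
  simp only [symbolAt, dif_pos h]
  rw [e, Fin.append_left, Fin.append_left, Fin.append_left, Fin.append_left]
  exact ⟨rfl, rfl⟩

lemma symbolAt_append_of_ge (u v u' v' : Fin m → Bool) {t : ℕ} (ht : m ≤ t) :
    symbolAt (Fin.append u v') (Fin.append v' u) t .alice =
        symbolAt (Fin.append u' v') (Fin.append v' u') t .alice ∧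
      symbolAt (Fin.append u v') (Fin.append v' u) t .bob =
        symbolAt (Fin.append u v) (Fin.append v u) t .bob := by
  by_cases h : t < m + m
  · have e : (⟨t, h⟩ : Fin (m + m)) = Fin.natAdd m ⟨t - m, by omega⟩ := by
      ext; simp; omega
    simp only [symbolAt, dif_pos h]
    rw [e, Fin.append_right, Fin.append_right, Fin.append_right, Fin.append_right]
    exact ⟨rfl, rfl⟩
  · simp [symbolAt, h]

/-- The executions on the encodings of `(u, v)` and `(u', v')` agree in all messages and in the
memories in the middle. -/
def SameTranscript (P : SCProtocol S) (r : Coins) (u v u' v' : Fin m → Bool) : Prop :=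
  (∀ t < m + m + 1, ∀ q, P.message (Fin.append u v) (Fin.append v u) r t q =
    P.message (Fin.append u' v') (Fin.append v' u') r t q) ∧
  ∀ q, P.memory (Fin.append u v) (Fin.append v u) r m q =
    P.memory (Fin.append u' v') (Fin.append v' u') r m q

/-- In the first half the mixed input shows Alice the string `u` and Bob the string `v'`, and the
initial memories depend only on the coins. -/
lemma memory_mixed_of_le (P : SCProtocol S) (r : Coins) {u v u' v' : Fin m → Bool}
    (h : P.SameTranscript r u v u' v') {t : ℕ} (ht : t ≤ m) :
    P.memory (Fin.append u v') (Fin.append v' u) r t .alice =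
        P.memory (Fin.append u v) (Fin.append v u) r t .alice ∧
      P.memory (Fin.append u v') (Fin.append v' u) r t .bob =
        P.memory (Fin.append u' v') (Fin.append v' u') r t .bob := by
  induction t with
  | zero => exact ⟨rfl, rfl⟩
  | succ t ih =>
    obtain ⟨h1, h2⟩ := ih (by omega)
    obtain ⟨s1, s2⟩ := symbolAt_append_of_lt u v u' v' (t := t) (by omega)
    exact (P.mixed_step r .alice h1 h2 s1 s2 (h.1 t (by omega))).2

/-- The players exchange executions at time `m`. The base case is the only place where equality of
the middle memories is needed here; afterwards Alice reads `v'` and Bob reads `u`. -/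
lemma memory_mixed_of_ge (P : SCProtocol S) (r : Coins) {u v u' v' : Fin m → Bool}
    (h : P.SameTranscript r u v u' v') {t : ℕ} (ht : m ≤ t) (ht' : t ≤ m + m) :
    P.memory (Fin.append u v') (Fin.append v' u) r t .alice =
        P.memory (Fin.append u' v') (Fin.append v' u') r t .alice ∧
      P.memory (Fin.append u v') (Fin.append v' u) r t .bob =
        P.memory (Fin.append u v) (Fin.append v u) r t .bob := by
  induction t, ht using Nat.le_induction with
  | base =>
    obtain ⟨h1, h2⟩ := P.memory_mixed_of_le r h le_rfl
    exact ⟨h1.trans (h.2 _), h2.trans (h.2 _).symm⟩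
  | succ t ht ih =>
    obtain ⟨h1, h2⟩ := ih (by omega)
    obtain ⟨s1, s2⟩ := symbolAt_append_of_ge u v u' v' ht
    exact (P.mixed_step r .alice h1 h2 s1 s2 fun q => (h.1 t (by omega) q).symm).2

/-- Executions with a given transcript form a rectangle. -/
lemma SameTranscript.mixed {P : SCProtocol S} {r : Coins} {u v u' v' : Fin m → Bool}
    (h : P.SameTranscript r u v u' v') : P.SameTranscript r u v' u v := by
  refine ⟨fun t ht => ?_, fun q => ?_⟩
  · rcases lt_or_ge t m with hm | hm
    · obtain ⟨h1, h2⟩ := P.memory_mixed_of_le r h hm.le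
      obtain ⟨s1, s2⟩ := symbolAt_append_of_lt u v u' v' hm
      exact (P.mixed_step r .alice h1 h2 s1 s2 (h.1 t ht)).1
    · obtain ⟨h1, h2⟩ := P.memory_mixed_of_ge r h hm (by omega)
      obtain ⟨s1, s2⟩ := symbolAt_append_of_ge u v u' v' hm
      intro q
      exact ((P.mixed_step r .alice h1 h2 s1 s2 fun q => (h.1 t ht q).symm).1 q).trans
        (h.1 t ht q).symm
  · obtain ⟨h1, h2⟩ := P.memory_mixed_of_le r h le_rfl
    cases q
    · exact h1
    · exact h2.trans (h.2 _).symm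

/-- Bob ends in the state of the first execution, but Alice in that of the second, so for her the
two outputs must be assumed equal. This is why the output is part of `transcript`. -/
lemma SameTranscript.result_mixed {P : SCProtocol S} {r : Coins} {u v u' v' : Fin m → Bool}
    (h : P.SameTranscript r u v u' v') {p : Player}
    (hres : P.result (Fin.append u v) (Fin.append v u) r p =
      P.result (Fin.append u' v') (Fin.append v' u') r p) :
    P.result (Fin.append u v') (Fin.append v' u) r p =
      P.result (Fin.append u v) (Fin.append v u) r p := by
  obtain ⟨h1, h2⟩ := P.memory_mixed_of_ge r h (Nat.le_add_left m m) le_rfl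
  have hm := h.mixed.1 (m + m) (by omega) p.other
  cases p
  · rw [hres, result, result, h1, hm, h.1 _ (by omega)]
  · rw [result, result, h2, hm]

/-- The messages exchanged in the time slots, the memories in the middle, and the output. -/
def transcript (P : SCProtocol S) (r : Coins) (p : Player) (z : (Fin m → Bool) × (Fin m → Bool)) :
    (Fin (m + m + 1) → Message × Message) × (Memory S × Memory S) × Bool :=
  let x := Fin.append z.1 z.2
  let y := Fin.append z.2 z.1
  (fun t => (P.message x y r t .alice, P.message x y r t .bob),
    (P.memory x y r m .alice, P.memory x y r m .bob), P.result x y r p)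

lemma transcript_eq_iff (P : SCProtocol S) (r : Coins) (p : Player) (u v u' v' : Fin m → Bool) :
    P.transcript r p (u, v) = P.transcript r p (u', v') ↔ P.SameTranscript r u v u' v' ∧
      P.result (Fin.append u v) (Fin.append v u) r p =
        P.result (Fin.append u' v') (Fin.append v' u') r p := by
  constructor
  · intro h
    simp only [transcript, Prod.mk.injEq, funext_iff] at h
    obtain ⟨h1, ⟨h2, h3⟩, h4⟩ := h
    refine ⟨⟨fun t ht q => ?_, fun q => ?_⟩, h4⟩
    · cases q
      · exact (h1 ⟨t, ht⟩).1
      · exact (h1 ⟨t, ht⟩).2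
    · cases q
      · exact funext h2
      · exact funext h3
  · rintro ⟨⟨h1, h2⟩, h3⟩
    simp only [transcript, Prod.mk.injEq]
    exact ⟨funext fun t => by rw [h1 t t.2, h1 t t.2], ⟨h2 _, h2 _⟩, h3⟩

/-- The number of rounds is a function of the transcript, so restricting to inputs with at most `T`
rounds keeps or discards whole fibres and preserves rectangles. -/
lemma rounds_eq_card (P : SCProtocol S) (r : Coins) (p : Player)
    (z : (Fin m → Bool) × (Fin m → Bool)) :
    P.rounds (Fin.append z.1 z.2) (Fin.append z.2 z.1) r =
      (Finset.univ.filter fun t => (P.transcript r p z).1 t ≠ ([], [])).card := by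
  classical
  rw [rounds, Finset.card_filter, Finset.sum_range, Finset.card_filter]
  refine Finset.sum_congr rfl fun t _ => if_congr ?_ rfl rfl
  simp only [transcript, ne_eq, Prod.mk.injEq, not_and_or]
  constructor
  · rintro ⟨q, hq⟩
    cases q
    · exact Or.inl hq
    · exact Or.inr hq
  · rintro (h | h)
    · exact ⟨_, h⟩
    · exact ⟨_, h⟩

open Classical in
-- Each player has `2 ^ S` memories and three symbols, hence at most `9 * 4 ^ S` message pairs occur
-- in a slot. The factor `4 ^ S * 2` counts the middle memories and the output bit.
lemma exists_finset_transcript (P : SCProtocol S) (r : Coins) (p : Player) (T : ℕ) :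
    ∃ L : Finset ((Fin (m + m + 1) → Message × Message) × (Memory S × Memory S) × Bool),
      L.card ≤ ((m + m + 1) * (9 * 4 ^ S) + 1) ^ T * (4 ^ S * 2) ∧
      ∀ z : (Fin m → Bool) × (Fin m → Bool),
        P.rounds (Fin.append z.1 z.2) (Fin.append z.2 z.1) r ≤ T → P.transcript r p z ∈ L := by
  let K : Finset (Message × Message) := Finset.univ.image
    fun a : (Memory S × StreamSymbol) × (Memory S × StreamSymbol) =>
      (P.send .alice a.1.1 a.1.2 r, P.send .bob a.2.1 a.2.2 r)
  have hK : K.card ≤ 9 * 4 ^ S := by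
    refine Finset.card_image_le.trans (le_of_eq ?_)
    simp only [Finset.card_univ, Fintype.card_prod, Fintype.card_fun, Fintype.card_bool,
      Fintype.card_fin, Fintype.card_option]
    rw [show (4 : ℕ) = 2 * 2 from rfl, mul_pow]
    ring
  obtain ⟨F, hF, hmem⟩ := exists_finset_sparse (N := m + m + 1) K ([], []) T
  refine ⟨F ×ˢ Finset.univ, ?_, fun z hz => ?_⟩
  · rw [Finset.card_product]
    refine Nat.mul_le_mul (hF.trans (by gcongr)) (le_of_eq ?_)
    simp only [Finset.card_univ, Fintype.card_prod, Fintype.card_fun, Fintype.card_bool,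
      Fintype.card_fin]
    rw [show (4 : ℕ) = 2 * 2 from rfl, mul_pow]
  · refine Finset.mem_product.2 ⟨hmem _ (fun t => ?_) ?_, Finset.mem_univ _⟩
    · exact Finset.mem_image.2 ⟨((_, _), (_, _)), Finset.mem_univ _, rfl⟩
    · rw [← rounds_eq_card]
      exact hz

open Classical in
/-- For fixed coins, the advantage of a protocol, restricted to the inputs with few rounds. -/
lemma sum_sign_mul_ipSign_le (P : SCProtocol S) (r : Coins) (p : Player) (T : ℕ) :
    ∑ z : (Fin m → Bool) × (Fin m → Bool) with
        P.rounds (Fin.append z.1 z.2) (Fin.append z.2 z.1) r ≤ T,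
      (if P.result (Fin.append z.1 z.2) (Fin.append z.2 z.1) r p then -1 else 1) *
        ipSign z.1 z.2 ≤
    ((((m + m + 1) * (9 * 4 ^ S) + 1) ^ T * (4 ^ S * 2) : ℕ) : ℝ) * √(8 ^ m) := by
  obtain ⟨L, hL, hmem⟩ := P.exists_finset_transcript (m := m) r p T
  refine (StreamComm.sum_sign_mul_ipSign_le (P.transcript r p)
    (fun z => P.result (Fin.append z.1 z.2) (Fin.append z.2 z.1) r p) _ L ?_ ?_ ?_).trans ?_
  · intro z hz
    exact hmem z (Finset.mem_filter.1 hz).2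
  · rintro ⟨u, v⟩ hp ⟨u', v'⟩ hq h
    obtain ⟨h1, h2⟩ := (P.transcript_eq_iff r p _ _ _ _).1 h
    have h3 : P.transcript r p (u, v') = P.transcript r p (u, v) :=
      (P.transcript_eq_iff r p _ _ _ _).2 ⟨h1.mixed, h1.result_mixed h2⟩
    refine ⟨Finset.mem_filter.2 ⟨Finset.mem_univ _, ?_⟩, h3⟩
    rw [P.rounds_eq_card r p, h3, ← P.rounds_eq_card r p]
    exact (Finset.mem_filter.1 hp).2
  · rintro ⟨u, v⟩ _ ⟨u', v'⟩ _ h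
    exact ((P.transcript_eq_iff r p _ _ _ _).1 h).2
  · gcongr

end SCProtocol

/-! ### Measurability of executions and the tail of the number of rounds. -/

open MeasureTheory

instance : IsProbabilityMeasure coinMeasure := by
  unfold coinMeasure
  infer_instance

/-- Memories and messages are random and are fed into random maps; as they range over countable
types, one can split according to their value. -/
lemma measurableSet_eval_eq {Ω α β : Type*} [MeasurableSpace Ω] [Countable α] {g : Ω → α}
    (hg : ∀ a, MeasurableSet {r | g r = a}) {h : α → Ω → β}
    (hh : ∀ a b, MeasurableSet {r | h a r = b}) (b : β) :
    MeasurableSet {r | h (g r) r = b} := by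
  have : {r | h (g r) r = b} = ⋃ a, {r | g r = a} ∩ {r | h a r = b} := by
    ext r
    simp
  rw [this]
  exact MeasurableSet.iUnion fun a => (hg a).inter (hh a b)

namespace SCProtocol

variable {S N m : ℕ}

lemma measurableSet_message_of_memory (P : SCProtocol S) (x y : Fin N → Bool) (t : ℕ)
    (p : Player) (h : ∀ s, MeasurableSet {r | P.memory x y r t p = s}) (w : Message) :
    MeasurableSet {r | P.message x y r t p = w} :=
  measurableSet_eval_eq (h := fun s r => P.send p s (symbolAt x y t p) r) h
    (fun s w => P.measurable_send p s _ w) w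

lemma measurableSet_memory (P : SCProtocol S) (x y : Fin N → Bool) (t : ℕ) (p : Player)
    (s : Memory S) : MeasurableSet {r | P.memory x y r t p = s} := by
  induction t generalizing p s with
  | zero => exact P.measurable_init p s
  | succ t ih =>
    refine measurableSet_eval_eq
      (h := fun w r => P.update p w (P.memory x y r t p) (symbolAt x y t p) r)
      (P.measurableSet_message_of_memory x y t p.other (ih p.other)) (fun w s => ?_) s
    exact measurableSet_eval_eq (h := fun s r => P.update p w s (symbolAt x y t p) r) (ih p)
      (fun s s' => P.measurable_update p w s _ s') s

lemma measurableSet_message (P : SCProtocol S) (x y : Fin N → Bool) (t : ℕ) (p : Player)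
    (w : Message) : MeasurableSet {r | P.message x y r t p = w} :=
  P.measurableSet_message_of_memory x y t p (P.measurableSet_memory x y t p) w

lemma measurableSet_result (P : SCProtocol S) (x y : Fin N → Bool) (p : Player) (b : Bool) :
    MeasurableSet {r | P.result x y r p = b} := by
  refine measurableSet_eval_eq (h := fun w r => P.output p w (P.memory x y r N p) r)
    (P.measurableSet_message x y N p.other) (fun w b => ?_) b
  exact measurableSet_eval_eq (h := fun s r => P.output p w s r) (P.measurableSet_memory x y N p)
    (fun s b => P.measurable_output p w s b) b

lemma measurable_rounds (P : SCProtocol S) (x y : Fin N → Bool) :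
    Measurable fun r => (P.rounds x y r : ℝ≥0∞) := by
  classical
  have h : ∀ r, (P.rounds x y r : ℝ≥0∞) =
      ∑ t ∈ Finset.range (N + 1), if ∃ p, P.message x y r t p ≠ [] then 1 else 0 := by
    intro r
    rw [rounds, Finset.card_filter]
    push_cast
    rfl
  simp_rw [h]
  refine Finset.measurable_sum _ fun t _ => ?_
  refine Measurable.ite ?_ measurable_const measurable_const
  have : {r | ∃ p, P.message x y r t p ≠ []} =
      {r | P.message x y r t .alice = []}ᶜ ∪ {r | P.message x y r t .bob = []}ᶜ := by
    ext r
    constructor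
    · rintro ⟨q, hq⟩
      cases q
      · exact Or.inl hq
      · exact Or.inr hq
    · rintro (h | h)
      · exact ⟨_, h⟩
      · exact ⟨_, h⟩
  rw [this]
  exact (P.measurableSet_message x y t _ _).compl.union (P.measurableSet_message x y t _ _).compl

lemma measurableSet_lt_rounds (P : SCProtocol S) (x y : Fin N → Bool) (T : ℕ) :
    MeasurableSet {r | T < P.rounds x y r} := by
  have : {r | T < P.rounds x y r} = {r | (T : ℝ≥0∞) < (P.rounds x y r : ℝ≥0∞)} := by
    ext r
    simp
  rw [this]
  exact measurableSet_lt measurable_const (P.measurable_rounds x y)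

/-- Markov's inequality for the number of rounds. -/
lemma measure_lt_rounds_le (P : SCProtocol S) {R : ℝ≥0} (hR : P.UsesRounds N R)
    (x y : Fin N → Bool) (T : ℕ) :
    coinMeasure {r | T < P.rounds x y r} ≤ R / (T + 1) := by
  have h := meas_ge_le_lintegral_div (μ := coinMeasure) (P.measurable_rounds x y).aemeasurable
    (ε := ((T + 1 : ℕ) : ℝ≥0∞)) (by simp) (by simp)
  have : {r | T < P.rounds x y r} =
      {r | ((T + 1 : ℕ) : ℝ≥0∞) ≤ (P.rounds x y r : ℝ≥0∞)} := by
    ext r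
    simp only [Set.mem_ofPred_eq, Nat.cast_le]
    rfl
  rw [this]
  refine h.trans ?_
  push_cast
  gcongr
  exact hR x y

/-! ### A constant lower bound on the expected number of rounds. -/

lemma memory_eq_of_silent (P : SCProtocol S) (r : Coins) {x y x' y' : Fin N → Bool} {p : Player}
    (hsym : ∀ t, symbolAt x y t p = symbolAt x' y' t p)
    (h : ∀ t < N + 1, ∀ q, P.message x y r t q = [])
    (h' : ∀ t < N + 1, ∀ q, P.message x' y' r t q = []) {t : ℕ} (ht : t ≤ N) :
    P.memory x y r t p = P.memory x' y' r t p := by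
  induction t with
  | zero => rfl
  | succ t ih =>
    rw [memory_succ, memory_succ, ih (by omega), h t (by omega), h' t (by omega), hsym]

lemma message_eq_nil_of_rounds (P : SCProtocol S) (r : Coins) {x y : Fin N → Bool}
    (h : P.rounds x y r ≤ 0) : ∀ t < N + 1, ∀ q, P.message x y r t q = [] := by
  classical
  intro t ht q
  by_contra hne
  rw [rounds, Nat.le_zero, Finset.card_eq_zero] at h
  have := Finset.filter_eq_empty_iff.1 h (Finset.mem_range.2 ht)
  exact this ⟨q, hne⟩

/-- Silent executions that look the same to a player give the same output. -/
lemma result_eq_of_silent (P : SCProtocol S) (r : Coins) {x y x' y' : Fin N → Bool} {p : Player}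
    (hsym : ∀ t, symbolAt x y t p = symbolAt x' y' t p)
    (h : P.rounds x y r ≤ 0) (h' : P.rounds x' y' r ≤ 0) :
    P.result x y r p = P.result x' y' r p := by
  have h := P.message_eq_nil_of_rounds r h
  have h' := P.message_eq_nil_of_rounds r h'
  rw [result, result, P.memory_eq_of_silent r hsym h h' le_rfl, h N (by omega), h' N (by omega)]

/-- Two inputs with different values that look the same to the output player force
communication. -/
lemma one_le_of_indistinguishable (P : SCProtocol S) {f : (Fin N → Bool) → (Fin N → Bool) → Bool}
    {ε : ℝ} {R : ℝ≥0} (hε : 0 ≤ ε) (hR : P.UsesRounds N R) {p : Player}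
    (hP : ∀ x y, coinMeasure {r | P.result x y r p ≠ f x y} ≤ ENNReal.ofReal ε)
    {x y x' y' : Fin N → Bool} (hsym : ∀ t, symbolAt x y t p = symbolAt x' y' t p)
    (hf : f x y ≠ f x' y') : 1 - 2 * ε ≤ 2 * (R : ℝ) := by
  -- If the protocol is silent and correct on both inputs, the two values coincide. So one of four
  -- events always occurs: an error or some communication, on either input.
  have hcover : (Set.univ : Set Coins) ⊆
      ({r | P.result x y r p ≠ f x y} ∪ {r | P.result x' y' r p ≠ f x' y'}) ∪
        ({r | 0 < P.rounds x y r} ∪ {r | 0 < P.rounds x' y' r}) := by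
    intro r _
    by_contra hr
    simp only [Set.mem_union, Set.mem_ofPred_eq, not_or, not_not, not_lt] at hr
    obtain ⟨⟨h1, h2⟩, h3, h4⟩ := hr
    exact hf (h1.symm.trans ((P.result_eq_of_silent r hsym h3 h4).trans h2))
  have hround : ∀ x y : Fin N → Bool, coinMeasure {r | 0 < P.rounds x y r} ≤ R := by
    intro x y
    simpa using P.measure_lt_rounds_le hR x y 0
  have h : (1 : ℝ≥0∞) ≤
      (ENNReal.ofReal ε + ENNReal.ofReal ε) + ((R : ℝ≥0∞) + (R : ℝ≥0∞)) := by
    calc (1 : ℝ≥0∞) = coinMeasure Set.univ := measure_univ.symm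
      _ ≤ _ := measure_mono hcover
      _ ≤ _ := measure_union_le _ _
      _ ≤ _ := add_le_add ((measure_union_le _ _).trans (add_le_add (hP x y) (hP x' y')))
        ((measure_union_le _ _).trans (add_le_add (hround x y) (hround x' y')))
  have h2 : ENNReal.ofReal 1 ≤ ENNReal.ofReal ((ε + ε) + ((R : ℝ) + R)) := by
    rw [ENNReal.ofReal_add (by positivity) (by positivity), ENNReal.ofReal_add hε hε,
      ENNReal.ofReal_add (by positivity) (by positivity), ENNReal.ofReal_coe_nnreal,
      ENNReal.ofReal_one]
    exact h
  have h3 := (ENNReal.ofReal_le_ofReal_iff (by positivity)).1 h2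
  linarith

end SCProtocol

/-! ### The lower bound for `ipEq`, from correlation to rounds times memory. -/

lemma firstHalf_append {m : ℕ} (u v : Fin m → Bool) : firstHalf (Fin.append u v) = u :=
  funext fun i => Fin.append_left u v i

lemma secondHalf_append {m : ℕ} (u v : Fin m → Bool) : secondHalf (Fin.append u v) = v :=
  funext fun i => Fin.append_right u v i

lemma ipEq_append {m : ℕ} (u v : Fin m → Bool) :
    ipEq m (Fin.append u v) (Fin.append v u) = innerProduct u v := by
  simp [ipEq, firstHalf_append, secondHalf_append]

namespace SCProtocol

variable {S m : ℕ}

/-- A protocol for `ipEq m` uses at least a constant number of rounds. -/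
lemma one_sub_le_rounds (P : SCProtocol S) (hm : 1 ≤ m) {ε : ℝ} {R : ℝ≥0} (hε : 0 ≤ ε)
    (hP : P.Computes (ipEq m) ε) (hR : P.UsesRounds (m + m) R) : 1 - 2 * ε ≤ 2 * (R : ℝ) := by
  obtain ⟨p, hp⟩ := hP
  -- With a unit vector in every half the value is true; replacing the other player's first half by
  -- zero makes it false without changing what player `p` reads.
  let e : Fin m → Bool := fun i => decide (i = ⟨0, hm⟩)
  let o : Fin m → Bool := fun _ => false
  have he : innerProduct e e = true := by
    have : ∑ i, (e i && e i).toNat = 1 := by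
      rw [Finset.sum_eq_single ⟨0, hm⟩]
      · simp [e]
      · intro i _ hi
        simp [e, hi]
      · simp
    rw [innerProduct, this]
    rfl
  have ho : innerProduct o e = false ∧ innerProduct e o = false := by
    simp [innerProduct, o]
  have h1 : ipEq m (Fin.append e e) (Fin.append e e) = true := by
    rw [ipEq_append, he]
  cases p
  · refine P.one_le_of_indistinguishable hε hR hp (x := Fin.append e e) (y := Fin.append e e)
      (x' := Fin.append e e) (y' := Fin.append o e) (fun t => rfl) ?_
    rw [h1]
    simp [ipEq, firstHalf_append, ho.2]
  · refine P.one_le_of_indistinguishable hε hR hp (x := Fin.append e e) (y := Fin.append e e)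
      (x' := Fin.append o e) (y' := Fin.append e e) (fun t => rfl) ?_
    rw [h1]
    simp [ipEq, firstHalf_append, ho.1]

open Classical in
/-- Some fixed coins are good on average over the inputs. -/
lemma exists_coins (P : SCProtocol S) {ε δ : ℝ} {R : ℝ≥0} (hε : 0 ≤ ε) (hδ : 0 ≤ δ) {p : Player}
    (hP : ∀ x y, coinMeasure {r | P.result x y r p ≠ ipEq m x y} ≤ ENNReal.ofReal ε)
    (hR : P.UsesRounds (m + m) R) {T : ℕ} (hT : (R : ℝ) ≤ δ * (T + 1)) :
    ∃ r, ∑ z : (Fin m → Bool) × (Fin m → Bool),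
      ((if T < P.rounds (Fin.append z.1 z.2) (Fin.append z.2 z.1) r then (1 : ℝ) else 0) +
        2 * if P.result (Fin.append z.1 z.2) (Fin.append z.2 z.1) r p ≠ innerProduct z.1 z.2
          then 1 else 0) ≤ 4 ^ m * (δ + 2 * ε) := by
  let A : (Fin m → Bool) × (Fin m → Bool) → Set Coins := fun z =>
    {r | T < P.rounds (Fin.append z.1 z.2) (Fin.append z.2 z.1) r}
  let B : (Fin m → Bool) × (Fin m → Bool) → Set Coins := fun z =>
    {r | P.result (Fin.append z.1 z.2) (Fin.append z.2 z.1) r p ≠ innerProduct z.1 z.2}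
  have hA : ∀ z, MeasurableSet (A z) := fun z => P.measurableSet_lt_rounds _ _ _
  have hB : ∀ z, MeasurableSet (B z) := fun z => (P.measurableSet_result _ _ _ _).compl
  have hμA : ∀ z, coinMeasure (A z) ≤ ENNReal.ofReal δ := by
    intro z
    refine (P.measure_lt_rounds_le hR _ _ T).trans ?_
    rw [ENNReal.div_le_iff (by simp) (by simp), ← ENNReal.ofReal_coe_nnreal,
      ← Nat.cast_add_one, ← ENNReal.ofReal_natCast, ← ENNReal.ofReal_mul hδ]
    exact ENNReal.ofReal_le_ofReal (by push_cast; exact hT)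
  have hμB : ∀ z, coinMeasure (B z) ≤ ENNReal.ofReal ε := by
    intro z
    have := hP (Fin.append z.1 z.2) (Fin.append z.2 z.1)
    rwa [ipEq_append] at this
  -- The weights match the loss of correlation: an input with too many rounds is dropped and loses
  -- 1, a wrong sign loses 2.
  let g : Coins → ℝ≥0∞ := fun r => ∑ z, ((A z).indicator 1 r + 2 * (B z).indicator 1 r)
  have hg : Measurable g := Finset.measurable_sum _ fun z _ =>
    (measurable_one.indicator (hA z)).add ((measurable_one.indicator (hB z)).const_mul 2)
  have hint : ∫⁻ r, g r ∂coinMeasure ≤ ENNReal.ofReal (4 ^ m * (δ + 2 * ε)) := by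
    have h1 : ∀ z, Measurable fun r => (A z).indicator (1 : Coins → ℝ≥0∞) r +
        2 * (B z).indicator (1 : Coins → ℝ≥0∞) r := fun z =>
      (measurable_one.indicator (hA z)).add ((measurable_one.indicator (hB z)).const_mul 2)
    rw [lintegral_finsetSum _ fun z _ => h1 z]
    have h2 : ∀ z, ∫⁻ r, ((A z).indicator 1 r + 2 * (B z).indicator 1 r) ∂coinMeasure ≤
        ENNReal.ofReal (δ + 2 * ε) := by
      intro z
      rw [lintegral_add_left (measurable_one.indicator (hA z)),
        lintegral_const_mul _ (measurable_one.indicator (hB z)), lintegral_indicator_one (hA z),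
        lintegral_indicator_one (hB z), ENNReal.ofReal_add hδ (by positivity),
        ENNReal.ofReal_mul (by norm_num), ENNReal.ofReal_ofNat]
      gcongr
      · exact hμA z
      · exact hμB z
    refine (Finset.sum_le_card_nsmul _ _ _ fun z _ => h2 z).trans (le_of_eq ?_)
    rw [nsmul_eq_mul, ENNReal.ofReal_mul (by positivity), Finset.card_univ]
    congr 1
    simp only [Fintype.card_prod, Fintype.card_fun, Fintype.card_bool, Fintype.card_fin]
    rw [← mul_pow, ← ENNReal.ofReal_natCast]
    norm_num
  obtain ⟨r, hr⟩ := exists_le_lintegral (μ := coinMeasure) hg.aemeasurable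
  refine ⟨r, ?_⟩
  rw [← ENNReal.ofReal_le_ofReal_iff (by positivity)]
  refine le_trans (le_of_eq ?_) (hr.trans hint)
  rw [ENNReal.ofReal_sum_of_nonneg fun z _ => by positivity]
  refine Finset.sum_congr rfl fun z _ => ?_
  rw [ENNReal.ofReal_add (by positivity) (by positivity), ENNReal.ofReal_mul (by norm_num),
    ENNReal.ofReal_ofNat]
  simp only [Set.indicator_apply, Pi.one_apply, A, B, Set.mem_ofPred_eq]
  congr 1
  · split_ifs <;> simp
  · split_ifs <;> simp

/-- A protocol with few rounds has many transcripts. -/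
lemma le_transcripts (P : SCProtocol S) {ε : ℝ} {R : ℝ≥0} (hε0 : 0 ≤ ε) (hε : ε < 1 / 2)
    (hP : P.Computes (ipEq m) ε) (hR : P.UsesRounds (m + m) R) {T : ℕ}
    (hT : (R : ℝ) ≤ (1 / 2 - ε) * (T + 1)) :
    (1 / 2 - ε) * √(2 ^ m) ≤ (((m + m + 1) * (9 * 4 ^ S) + 1) ^ T * (4 ^ S * 2) : ℕ) := by
  obtain ⟨p, hp⟩ := hP
  obtain ⟨r, hr⟩ := P.exists_coins hε0 (by linarith : 0 ≤ 1 / 2 - ε) hp hR hT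
  have hcorr := P.sum_sign_mul_ipSign_le (m := m) r p T
  set L : ℝ := ((((m + m + 1) * (9 * 4 ^ S) + 1) ^ T * (4 ^ S * 2) : ℕ) : ℝ) with hL
  have hlow : (1 / 2 - ε) * 4 ^ m ≤ L * √(8 ^ m) := by
    refine le_trans ?_ hcorr
    rw [Finset.sum_filter]
    have hcard : ∑ z : (Fin m → Bool) × (Fin m → Bool), (1 : ℝ) = 4 ^ m := by
      simp only [Finset.sum_const, Finset.card_univ, Fintype.card_prod, Fintype.card_fun,
        Fintype.card_bool, Fintype.card_fin, nsmul_eq_mul, mul_one]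
      rw [← mul_pow]
      norm_num
    -- With `δ = 1/2 - ε` the average loss is at most `δ + 2ε = 1/2 + ε`, which leaves `1/2 - ε`.
    have : (1 / 2 - ε) * 4 ^ m ≤ ∑ z : (Fin m → Bool) × (Fin m → Bool), ((1 : ℝ) -
        ((if T < P.rounds (Fin.append z.1 z.2) (Fin.append z.2 z.1) r then (1 : ℝ) else 0) +
        2 * if P.result (Fin.append z.1 z.2) (Fin.append z.2 z.1) r p ≠ innerProduct z.1 z.2
          then 1 else 0)) := by
      rw [Finset.sum_sub_distrib, hcard]
      linarith
    refine this.trans (Finset.sum_le_sum fun z _ => ?_)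
    rw [ipSign_eq]
    by_cases h : T < P.rounds (Fin.append z.1 z.2) (Fin.append z.2 z.1) r
    · rw [if_pos h, if_neg (not_le.2 h)]
      split_ifs <;> norm_num
    · rw [if_neg h, if_pos (not_lt.1 h)]
      cases P.result (Fin.append z.1 z.2) (Fin.append z.2 z.1) r p <;>
        cases innerProduct z.1 z.2 <;> norm_num
  have h8 : √((8 : ℝ) ^ m) * √(2 ^ m) = 4 ^ m := by
    rw [← Real.sqrt_mul (by positivity), ← mul_pow]
    rw [show ((8 : ℝ) * 2) = 4 ^ 2 by norm_num, ← pow_mul, mul_comm, pow_mul,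
      Real.sqrt_sq (by positivity)]
  have hpos : 0 < √((8 : ℝ) ^ m) := Real.sqrt_pos.2 (by positivity)
  refine le_of_mul_le_mul_right ?_ hpos
  calc (1 / 2 - ε) * √(2 ^ m) * √(8 ^ m) = (1 / 2 - ε) * 4 ^ m := by rw [← h8]; ring
    _ ≤ _ := hlow

/-- The logarithmic form of `le_transcripts`. -/
lemma half_log_le (P : SCProtocol S) (hm : 1 ≤ m) {ε : ℝ} {R : ℝ≥0} (hε0 : 0 ≤ ε)
    (hε : ε < 1 / 2) (hP : P.Computes (ipEq m) ε) (hR : P.UsesRounds (m + m) R) :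
    m * Real.log 2 / 2 ≤ R / (1 / 2 - ε) * (4 + Real.log ((m + m : ℕ) : ℝ) + 2 * S) +
      2 * S + 1 + 1 / (1 / 2 - ε) := by
  set δ : ℝ := 1 / 2 - ε with hδ
  have hδ0 : 0 < δ := by rw [hδ]; linarith
  -- The floor gives both `R ≤ δ (T + 1)`, needed for Markov's inequality, and `T ≤ R / δ`.
  set T : ℕ := ⌊(R : ℝ) / δ⌋₊ with hTdef
  have hT : (R : ℝ) ≤ δ * (T + 1) := by
    have := (Nat.lt_floor_add_one ((R : ℝ) / δ)).le
    rw [div_le_iff₀ hδ0] at this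
    linarith
  have hT' : (T : ℝ) ≤ R / δ := Nat.floor_le (by positivity)
  have h := Real.log_le_log (by positivity) (P.le_transcripts hε0 hε hP hR hT)
  have hmR : (1 : ℝ) ≤ m := by exact_mod_cast hm
  rw [Real.log_mul hδ0.ne' (by positivity), Real.log_sqrt (by positivity), Real.log_pow] at h
  push_cast at h
  rw [Real.log_mul (by positivity) (by positivity), Real.log_pow,
    Real.log_mul (by positivity) (by positivity), Real.log_pow] at h
  have hl2 : Real.log 2 ≤ 1 := by
    have := Real.log_le_sub_one_of_pos (show (0 : ℝ) < 2 by norm_num)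
    linarith
  have hl4 : Real.log 4 ≤ 2 := by
    rw [show (4 : ℝ) = 2 ^ 2 by norm_num, Real.log_pow]
    push_cast
    linarith
  have hl16 : Real.log 16 ≤ 4 := by
    rw [show (16 : ℝ) = 2 ^ 4 by norm_num, Real.log_pow]
    push_cast
    linarith
  have hlogδ : -Real.log δ ≤ 1 / δ := by
    have := Real.log_le_sub_one_of_pos (show (0 : ℝ) < 1 / δ by positivity)
    rw [one_div, Real.log_inv] at this
    rw [one_div]
    linarith
  have h4 : (1 : ℝ) ≤ 4 ^ S := one_le_pow₀ (by norm_num)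
  have hn0 : ((m + m : ℕ) : ℝ) ≠ 0 := by
    exact_mod_cast (by omega : m + m ≠ 0)
  have hbase : Real.log ((m + m + 1) * (9 * 4 ^ S) + 1) ≤
      4 + Real.log ((m + m : ℕ) : ℝ) + 2 * S := by
    -- With `n = m + m ≥ 2` one has `9 (n + 1) + 1 ≤ 16 n`, and `log 16 ≤ 4` gives the constant `4`.
    have h1 : ((m : ℝ) + m + 1) * (9 * 4 ^ S) + 1 ≤ 16 * ((m + m : ℕ) : ℝ) * 4 ^ S := by
      push_cast
      nlinarith
    refine (Real.log_le_log (by positivity) h1).trans ?_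
    rw [Real.log_mul (by positivity) (by positivity), Real.log_mul (by norm_num) hn0,
      Real.log_pow]
    nlinarith [(Nat.cast_nonneg S : (0 : ℝ) ≤ S)]
  have hlogn : 0 ≤ Real.log ((m + m : ℕ) : ℝ) := Real.log_natCast_nonneg _
  have hTl : (T : ℝ) * Real.log ((m + m + 1) * (9 * 4 ^ S) + 1) ≤
      R / δ * (4 + Real.log ((m + m : ℕ) : ℝ) + 2 * S) :=
    (mul_le_mul_of_nonneg_left hbase (by positivity)).trans
      (mul_le_mul_of_nonneg_right hT' (by positivity))
  have hS : (S : ℝ) * Real.log 4 ≤ S * 2 := mul_le_mul_of_nonneg_left hl4 (by positivity)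
  linarith

/-- The lower bound on the product of rounds and memory. -/
theorem rounds_mul_memory_ge {ε c₀ : ℝ} (hε0 : 0 ≤ ε) (hε : ε < 1 / 2) (hc₀ : 0 < c₀) :
    ∃ c : ℝ, 0 < c ∧ ∀ (m S : ℕ) (P : SCProtocol S) (R : ℝ≥0),
      c₀ * Real.log ((m + m : ℕ) : ℝ) ≤ (S : ℝ) → P.Computes (ipEq m) ε →
        P.UsesRounds (m + m) R → c * ((m + m : ℕ) : ℝ) ≤ (R : ℝ) * (S : ℝ) := by
  set δ : ℝ := 1 / 2 - ε with hδ
  have hδ0 : 0 < δ := by rw [hδ]; linarith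
  -- `6 + 1 / c₀` comes from the factor multiplying `R / δ`, with `log n ≤ S / c₀`, and `3 + 1 / δ`
  -- from the remaining terms; the outer division is that of `R / δ`.
  set D : ℝ := (9 + 1 / c₀ + 1 / δ) / δ with hD
  have hD0 : 0 < D := by positivity
  refine ⟨1 / (8 * D), by positivity, fun m S P R hS hP hR => ?_⟩
  rcases Nat.eq_zero_or_pos m with rfl | hm
  · simp only [add_zero, Nat.cast_zero, mul_zero]
    positivity
  have hlogn : Real.log 2 ≤ Real.log ((m + m : ℕ) : ℝ) := by
    refine Real.log_le_log (by norm_num) ?_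
    exact_mod_cast (by omega : 2 ≤ m + m)
  have hlog2 : 1 / 2 ≤ Real.log 2 := by
    have := Real.log_two_gt_d9
    linarith
  have hS1 : (1 : ℝ) ≤ S := by
    have : (0 : ℝ) < S := lt_of_lt_of_le (mul_pos hc₀ (by linarith)) hS
    exact_mod_cast Nat.one_le_iff_ne_zero.2 (by rintro rfl; simp at this)
  have hlogS : Real.log ((m + m : ℕ) : ℝ) ≤ 1 / c₀ * S := by
    rw [one_div, inv_mul_eq_div, le_div_iff₀ hc₀]
    linarith
  -- Since `R ≥ δ`, the terms free of `R` can be multiplied by `R / δ`.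
  have hRδ : 1 ≤ R / δ := by
    rw [le_div_iff₀ hδ0]
    have := P.one_sub_le_rounds hm hε0 hP hR
    linarith
  have hQ := P.half_log_le hm hε0 hε hP hR
  rw [← hδ] at hQ
  have hq : (R : ℝ) * S * D = R / δ * (S * (9 + 1 / c₀ + 1 / δ)) := by
    rw [hD]; field_simp
  have hmain : (m : ℝ) * Real.log 2 / 2 ≤ R * S * D := by
    refine hQ.trans ?_
    rw [hq]
    set q : ℝ := R / δ with hqdef
    have h1 : q * (4 + Real.log ((m + m : ℕ) : ℝ) + 2 * S) ≤ q * (S * (6 + 1 / c₀)) :=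
      mul_le_mul_of_nonneg_left (by linarith) (by linarith)
    have h2 : 2 * (S : ℝ) + 1 + 1 / δ ≤ S * (3 + 1 / δ) := by
      have : 1 / δ ≤ S * (1 / δ) := le_mul_of_one_le_left (by positivity) hS1
      linarith
    have h3 : (S : ℝ) * (3 + 1 / δ) ≤ q * (S * (3 + 1 / δ)) :=
      le_mul_of_one_le_left (by positivity) hRδ
    linarith
  have hm' : (m : ℝ) / 4 ≤ R * S * D := by
    have : (m : ℝ) * (1 / 2) ≤ m * Real.log 2 :=
      mul_le_mul_of_nonneg_left hlog2 (by positivity)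
    linarith
  rw [one_div, inv_mul_eq_div, div_le_iff₀ (by positivity)]
  push_cast
  linarith

end SCProtocol

/-! ### Finitely many coins -/

section Coins

variable {k N : ℕ}

/-- A table of `k` times `N` coins. -/
def coinTable (k N : ℕ) (r : Coins) : Fin k → Fin N → Bool := fun j l => r (Nat.pair j l)

lemma measurableSet_coinTable (p : (Fin k → Fin N → Bool) → Prop) :
    MeasurableSet {r | p (coinTable k N r)} := by
  have h : Measurable (coinTable k N) :=
    measurable_pi_lambda _ fun j => measurable_pi_lambda _ fun l => measurable_pi_apply _
  exact h (Set.toFinite {c | p c}).measurableSet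

/-- The pairing function is injective, so the event is a cylinder that fixes `k * N` distinct coins.
-/
lemma measure_coinTable_eq (c : Fin k → Fin N → Bool) :
    coinMeasure {r | coinTable k N r = c} = ((2 : ℝ≥0∞) ^ (k * N))⁻¹ := by
  let e : Fin k × Fin N ↪ ℕ := ⟨fun a => Nat.pair a.1 a.2, fun a b h => by
    obtain ⟨h1, h2⟩ := Nat.pair_eq_pair.1 h
    exact Prod.ext (Fin.ext h1) (Fin.ext h2)⟩
  let t : ℕ → Set Bool := fun n => {b | ∀ a, e a = n → b = c a.1 a.2}
  have hset : {r | coinTable k N r = c} = Set.pi (Finset.univ.map e : Finset ℕ) t := by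
    ext r
    constructor
    · rintro h n - a rfl
      exact congrFun (congrFun h a.1) a.2
    · intro h
      ext j l
      exact h (e (j, l)) (by simp) (j, l) rfl
  have ht : ∀ a, t (e a) = {c a.1 a.2} := by
    intro a
    ext b
    constructor
    · intro h
      exact h a rfl
    · rintro rfl a' h
      rw [e.injective h]
  rw [hset, coinMeasure, Measure.infinitePi_pi _ fun _ _ => (Set.toFinite _).measurableSet,
    Finset.prod_map]
  have h1 : ∀ a, (PMF.uniformOfFintype Bool).toMeasure (t (e a)) = 2⁻¹ := by
    intro a
    rw [ht, PMF.toMeasure_apply_singleton _ _ (MeasurableSet.singleton _)]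
    simp
  simp_rw [h1]
  rw [Finset.prod_const, Finset.card_univ, Fintype.card_prod, Fintype.card_fin, Fintype.card_fin,
    ENNReal.inv_pow]

/-- A bit as an element of `ZMod 2`. -/
def bit (b : Bool) : ZMod 2 := if b then 1 else 0

/-- The parity of the bits of `w` selected by `ρ`. -/
def parity (ρ w : Fin N → Bool) : ZMod 2 := ∑ l, bit (ρ l && w l)

/-- All `k` random parities of `x` and `w` agree. -/
def ParitiesAgree (c : Fin k → Fin N → Bool) (x w : Fin N → Bool) : Prop :=
  ∀ j, parity (c j) x = parity (c j) w

instance (c : Fin k → Fin N → Bool) (x w : Fin N → Bool) : Decidable (ParitiesAgree c x w) :=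
  inferInstanceAs (Decidable (∀ j, parity (c j) x = parity (c j) w))

/-- At a position `l₀` where `x` and `w` differ, the coin of each row enters exactly one of the two
parities, so agreement determines it from the rest of the row. Deleting that column is injective on
the agreeing tables. -/
lemma card_paritiesAgree_le {x w : Fin N → Bool} (h : x ≠ w) :
    2 ^ k * (Finset.univ.filter fun c : Fin k → Fin N → Bool => ParitiesAgree c x w).card ≤
      2 ^ (k * N) := by
  obtain ⟨l₀, hl₀⟩ := Function.ne_iff.1 h
  have hcard : (Finset.univ.filter fun c : Fin k → Fin N → Bool => ParitiesAgree c x w).card ≤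
      (Finset.univ : Finset (Fin k → {l // l ≠ l₀} → Bool)).card := by
    refine Finset.card_le_card_of_injOn (fun c j l => c j l) (fun _ _ => by simp) ?_
    intro c hc c' hc' hcc
    have hc := (Finset.mem_filter.1 (Finset.mem_coe.1 hc)).2
    have hc' := (Finset.mem_filter.1 (Finset.mem_coe.1 hc')).2
    have hne : ∀ j l, l ≠ l₀ → c j l = c' j l := fun j l hl =>
      congrFun (congrFun hcc j) ⟨l, hl⟩
    ext j l
    by_cases hl : l = l₀
    · subst hl
      have h1 := hc j
      have h2 := hc' j
      simp only [parity] at h1 h2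
      rw [← Finset.add_sum_erase _ _ (Finset.mem_univ l),
        ← Finset.add_sum_erase (f := fun l => bit (c j l && w l)) _ (Finset.mem_univ l)] at h1
      rw [← Finset.add_sum_erase _ _ (Finset.mem_univ l),
        ← Finset.add_sum_erase (f := fun l => bit (c' j l && w l)) _ (Finset.mem_univ l)] at h2
      have e : ∀ u : Fin N → Bool, ∑ i ∈ Finset.univ.erase l, bit (c j i && u i) =
          ∑ i ∈ Finset.univ.erase l, bit (c' j i && u i) := fun u =>
        Finset.sum_congr rfl fun i hi => by rw [hne j i (Finset.ne_of_mem_erase hi)]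
      rw [e, e] at h1
      generalize ∑ i ∈ Finset.univ.erase l, bit (c' j i && x i) = A at h1 h2
      generalize ∑ i ∈ Finset.univ.erase l, bit (c' j i && w i) = B at h1 h2
      revert h1 h2 hl₀
      generalize c j l = b₁
      generalize c' j l = b₂
      generalize x l = b₃
      generalize w l = b₄
      revert b₁ b₂ b₃ b₄ A B
      simp only [bit]
      decide
    · rw [hne j l hl]
  have hN : 1 ≤ N := Nat.one_le_iff_ne_zero.2 (by rintro rfl; exact l₀.elim0)
  simp only [Finset.card_univ, Fintype.card_fun, Fintype.card_bool, Fintype.card_fin,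
    Fintype.card_subtype_compl, Fintype.card_subtype_eq] at hcard
  calc _ ≤ 2 ^ k * (2 ^ (N - 1)) ^ k := Nat.mul_le_mul_left _ hcard
    _ = 2 ^ (k * N) := by
      rw [← pow_mul, ← pow_add]
      congr 1
      obtain ⟨n, rfl⟩ := Nat.exists_eq_add_of_le hN
      rw [Nat.add_sub_cancel_left]
      ring

/-- Random parities tell different strings apart, except with exponentially small probability. -/
lemma measure_paritiesAgree_le {x w : Fin N → Bool} (h : x ≠ w) :
    coinMeasure {r | ParitiesAgree (coinTable k N r) x w} ≤ ((2 : ℝ≥0∞) ^ k)⁻¹ := by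
  set C := Finset.univ.filter fun c : Fin k → Fin N → Bool => ParitiesAgree c x w with hC
  have hsub : {r | ParitiesAgree (coinTable k N r) x w} ⊆
      ⋃ c ∈ C, {r | coinTable k N r = c} := by
    intro r hr
    simp only [Set.mem_iUnion]
    exact ⟨_, Finset.mem_filter.2 ⟨Finset.mem_univ _, hr⟩, rfl⟩
  refine (measure_mono hsub).trans ((measure_biUnion_finset_le _ _).trans ?_)
  simp_rw [measure_coinTable_eq]
  rw [Finset.sum_const, nsmul_eq_mul, ← div_eq_mul_inv]
  refine ENNReal.div_le_of_le_mul ?_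
  rw [mul_comm, ← div_eq_mul_inv, ENNReal.le_div_iff_mul_le (by simp) (by simp), mul_comm]
  exact_mod_cast card_paritiesAgree_le h

end Coins

/-! ### The function as an equality test -/

section IpEq

variable {m : ℕ}

/-- Exchange of the two halves of a string. -/
def swapHalves (y : Fin (m + m) → Bool) : Fin (m + m) → Bool := fun i => y (finAddFlip i)

lemma swapHalves_castAdd (y : Fin (m + m) → Bool) (i : Fin m) :
    swapHalves y (Fin.castAdd m i) = y (Fin.natAdd m i) := by
  rw [swapHalves, finAddFlip_apply_castAdd]

lemma swapHalves_natAdd (y : Fin (m + m) → Bool) (i : Fin m) :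
    swapHalves y (Fin.natAdd m i) = y (Fin.castAdd m i) := by
  rw [swapHalves, finAddFlip_apply_natAdd]

lemma eq_swapHalves_iff (x y : Fin (m + m) → Bool) :
    x = swapHalves y ↔ firstHalf x = secondHalf y ∧ firstHalf y = secondHalf x := by
  constructor
  · rintro rfl
    exact ⟨funext fun i => swapHalves_castAdd y i, funext fun i => (swapHalves_natAdd y i).symm⟩
  · rintro ⟨h1, h2⟩
    ext i
    refine Fin.addCases (fun i => ?_) (fun i => ?_) i
    · exact (congrFun h1 i).trans (swapHalves_castAdd y i).symm
    · exact (congrFun h2 i).symm.trans (swapHalves_natAdd y i).symm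

lemma ipEq_eq (x y : Fin (m + m) → Bool) :
    ipEq m x y = (innerProduct (firstHalf x) (firstHalf y) && decide (x = swapHalves y)) := by
  rw [ipEq, Bool.and_assoc, ← Bool.decide_and]
  congr 2
  exact propext (eq_swapHalves_iff x y).symm

/-- If the equality test succeeds then `Y = Y'`, and Alice knows both arguments of the inner
product; otherwise both sides are false. -/
lemma ipEq_eq_alice (x y : Fin (m + m) → Bool) :
    ipEq m x y = (innerProduct (firstHalf x) (secondHalf x) && decide (x = swapHalves y)) := by
  rw [ipEq_eq]
  by_cases h : x = swapHalves y
  · rw [((eq_swapHalves_iff x y).1 h).2]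
  · simp [h]

lemma innerProduct_eq (u v : Fin m → Bool) :
    innerProduct u v = decide (∑ i, bit (u i && v i) = 1) := by
  have h : ∑ i, bit (u i && v i) = ((∑ i, (u i && v i).toNat : ℕ) : ZMod 2) := by
    push_cast
    refine Finset.sum_congr rfl fun i _ => ?_
    cases u i && v i <;> simp [bit]
  rw [innerProduct, h]
  congr 1
  rw [ZMod.natCast_eq_one_iff_odd, Nat.odd_iff]

/-- Replacing the equality test in `ipEq` by a comparison of random parities. -/
lemma measure_ne_ipEq_le (k : ℕ) (x y : Fin (m + m) → Bool) (a : Bool)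
    (ha : ipEq m x y = (a && decide (x = swapHalves y))) :
    coinMeasure {r | (a && decide (ParitiesAgree (coinTable k (m + m) r) x (swapHalves y))) ≠
      ipEq m x y} ≤ ((2 : ℝ≥0∞) ^ k)⁻¹ := by
  -- The error is one-sided: equal strings always have equal parities.
  by_cases h : x = swapHalves y
  · have hempty : {r | (a && decide (ParitiesAgree (coinTable k (m + m) r) x (swapHalves y))) ≠
        ipEq m x y} = ∅ := by
      ext r
      have hr : ParitiesAgree (coinTable k (m + m) r) x (swapHalves y) := fun j => by rw [← h]
      simp only [Set.mem_ofPred_eq, Set.mem_empty_iff_false, iff_false, not_not]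
      rw [ha, decide_eq_true hr, decide_eq_true h]
    rw [hempty]
    simp
  · refine (measure_mono ?_).trans (measure_paritiesAgree_le h)
    intro r hr
    by_contra hn
    refine hr ?_
    rw [ha]
    have hn' : ¬ ParitiesAgree (coinTable k (m + m) r) x (swapHalves y) := hn
    simp [h, hn']

end IpEq

/-! ### The communication protocol -/

namespace CommTree

variable {X Y : Type}

/-- Alice sends the bits `qs`, and the players continue with a tree that depends on them. -/
def aliceSends : List (X → Bool) → (List Bool → CommTree X Y) → CommTree X Y
  | [], next => next []
  | q :: qs, next => alice q fun b => aliceSends qs fun l => next (b :: l)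

lemma run_aliceSends (qs : List (X → Bool)) (next : List Bool → CommTree X Y) (x : X) (y : Y) :
    (aliceSends qs next).run x y = (next (qs.map fun q => q x)).run x y := by
  induction qs generalizing next with
  | nil => rfl
  | cons q qs ih => exact ih _

lemma length_transcript_aliceSends (qs : List (X → Bool)) (next : List Bool → CommTree X Y)
    (x : X) (y : Y) : ((aliceSends qs next).transcript x y).length =
      qs.length + ((next (qs.map fun q => q x)).transcript x y).length := by
  induction qs generalizing next with
  | nil => simp [aliceSends]
  | cons q qs ih =>
    simp only [aliceSends, transcript, List.length_cons, List.map_cons]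
    rw [ih]
    omega

end CommTree

section CommUpper

variable {k m : ℕ}

/-- Alice sends the inner product of the halves of her input and `k` parities; Bob compares. -/
def parityTree (c : Fin k → Fin (m + m) → Bool) :
    CommTree (Fin (m + m) → Bool) (Fin (m + m) → Bool) :=
  .alice (fun x => innerProduct (firstHalf x) (secondHalf x)) fun a =>
    CommTree.aliceSends ((List.finRange k).map fun j x => decide (parity (c j) x = 1)) fun l =>
      .bob (fun y => a && decide (l = (List.finRange k).map fun j =>
        decide (parity (c j) (swapHalves y) = 1))) .leaf

lemma run_parityTree (c : Fin k → Fin (m + m) → Bool) (x y : Fin (m + m) → Bool) :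
    (parityTree c).run x y = (innerProduct (firstHalf x) (secondHalf x) &&
      decide (ParitiesAgree c x (swapHalves y))) := by
  rw [parityTree, CommTree.run, CommTree.run_aliceSends, CommTree.run, CommTree.run]
  congr 1
  refine decide_eq_decide.2 ?_
  rw [List.map_map, List.map_inj_left]
  have h : ∀ a b : ZMod 2, (decide (a = 1) = decide (b = 1)) ↔ a = b := by decide
  exact ⟨fun hl j => (h _ _).1 (hl j (List.mem_finRange j)), fun hl j _ => (h _ _).2 (hl j)⟩

lemma length_transcript_parityTree (c : Fin k → Fin (m + m) → Bool) (x y : Fin (m + m) → Bool) :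
    ((parityTree c).transcript x y).length = k + 2 := by
  rw [parityTree, CommTree.transcript, List.length_cons, CommTree.length_transcript_aliceSends]
  simp [CommTree.transcript]

/-- One bit for the inner product, `k` parities and Bob's answer; the bound does not depend on `m`.
-/
theorem commComplexity_ipEq_le {ε : ℝ} (hk : ((2 : ℝ≥0∞) ^ k)⁻¹ ≤ ENNReal.ofReal ε) :
    commComplexity (ipEq m) ε ≤ (k + 2 : ℕ) := by
  let P : CommProtocol (Fin (m + m) → Bool) (Fin (m + m) → Bool) :=
    { tree := fun r => parityTree (coinTable k (m + m) r)
      measurable_run := fun x y b =>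
        measurableSet_coinTable fun c => (parityTree c).run x y = b }
  have hP : P.Computes (ipEq m) ε := by
    intro x y
    refine le_trans ?_ hk
    have := measure_ne_ipEq_le k x y _ (ipEq_eq_alice x y)
    simp_rw [← run_parityTree] at this
    exact this
  refine (iInf₂_le P hP).trans ?_
  refine iSup_le fun x => iSup_le fun y => iSup_le fun r => ?_
  rw [length_transcript_parityTree]

end CommUpper

/-! ### The streaming algorithm -/

section Streaming

/-- A streaming algorithm whose states form a finite type and whose steps depend on finitely many
coins. -/
lemma interleavedComplexity_le {σ : Type} [Fintype σ] {N S k L : ℕ} {ε : ℝ}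
    (f : (Fin N → Bool) → (Fin N → Bool) → Bool) (hσ : Fintype.card σ ≤ 2 ^ S) (init : σ)
    (step : (Fin k → Fin L → Bool) → σ → Bool → σ) (out : σ → Bool)
    (hf : ∀ x y, coinMeasure
      {r | out ((interleave x y).foldl (step (coinTable k L r)) init) ≠ f x y} ≤
        ENNReal.ofReal ε) :
    interleavedComplexity f ε ≤ S := by
  obtain ⟨enc⟩ : Nonempty (σ ↪ Memory S) :=
    Function.Embedding.nonempty_of_card_le (by simpa using hσ)
  have : Nonempty σ := ⟨init⟩
  have hdec : ∀ s, Function.invFun enc (enc s) = s := Function.leftInverse_invFun enc.injective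
  let A : StreamingAlgorithm S :=
    { init := fun _ => enc init
      step := fun s a r => enc (step (coinTable k L r) (Function.invFun enc s) a)
      output := fun s _ => out (Function.invFun enc s)
      measurable_init := fun s => MeasurableSet.const _
      measurable_step := fun s a s' => measurableSet_coinTable fun c =>
        enc (step c (Function.invFun enc s) a) = s'
      measurable_output := fun s b => MeasurableSet.const _ }
  have hfold : ∀ (l : List Bool) (s : σ) (r : Coins),
      l.foldl (fun s a => A.step s a r) (enc s) = enc (l.foldl (step (coinTable k L r)) s) := by
    intro l
    induction l with
    | nil => intro s r; rfl
    | cons a l ih =>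
      intro s r
      rw [List.foldl_cons, List.foldl_cons, ← ih]
      change l.foldl _ (enc (step (coinTable k L r) (Function.invFun enc (enc s)) a)) = _
      rw [hdec]
  have hA : A.ComputesInterleaved f ε := by
    intro x y
    have h : ∀ r, A.run (interleave x y) r =
        out ((interleave x y).foldl (step (coinTable k L r)) init) := by
      intro r
      change out (Function.invFun enc ((interleave x y).foldl _ (enc init))) = _
      rw [hfold, hdec]
    simp_rw [h]
    exact hf x y
  exact (iInf_le _ S).trans (iInf₂_le A hA)

lemma foldl_finRange_induction {σ : Type*} {N : ℕ} (F : σ → Fin N → σ) (I : ℕ → σ → Prop) (s : σ)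
    (h0 : I 0 s) (hs : ∀ (i : Fin N) (s : σ), I i s → I (i + 1) (F s i)) :
    I N ((List.finRange N).foldl F s) := by
  induction N generalizing s I with
  | zero => simpa using h0
  | succ n ih =>
    rw [List.finRange_succ, List.foldl_cons, List.foldl_map]
    exact ih (fun s i => F s i.succ) (fun i => I (i + 1)) (F s 0) (hs 0 s h0)
      fun i s h => hs i.succ s h

variable {k m : ℕ}

/-- States of the streaming algorithm: the number of pairs read, the last bit if it is an unpaired
bit of the first stream, the inner product so far, and the differences of parities so far. -/
abbrev ParityState (k m : ℕ) : Type :=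
  Fin (m + m + 1) × Option Bool × ZMod 2 × (Fin k → ZMod 2)

/-- The contribution of the pair in position `i` to the inner product of the first halves. -/
def ipTerm (i : Fin (m + m)) (a b : Bool) : ZMod 2 := if (i : ℕ) < m then bit (a && b) else 0

/-- The contribution of the pair in position `i` to the difference of the parities. -/
def parityTerm (ρ : Fin (m + m) → Bool) (i : Fin (m + m)) (a b : Bool) : ZMod 2 :=
  -- The bit of `y` at `i` stands at position `finAddFlip i` of `swapHalves y`, hence uses the coin
  -- of that position.
  bit (ρ i && a) + bit (ρ (finAddFlip i) && b)

def parityStep (c : Fin k → Fin (m + m) → Bool) : ParityState k m → Bool → ParityState k m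
  | (t, none, u, v), a => (t, some a, u, v)
  | (t, some a, u, v), b =>
    if h : (t : ℕ) < m + m then
      (t + 1, none, u + ipTerm ⟨t, h⟩ a b, fun j => v j + parityTerm (c j) ⟨t, h⟩ a b)
    -- Never reached on an interleaved stream of `m + m` pairs.
    else (t, some a, u, v)

lemma foldl_parityStep (c : Fin k → Fin (m + m) → Bool) (x y : Fin (m + m) → Bool) :
    ∃ t : Fin (m + m + 1), (interleave x y).foldl (parityStep c) (0, none, 0, fun _ => 0) =
      (t, none, ∑ i, ipTerm i (x i) (y i), fun j => ∑ i, parityTerm (c j) i (x i) (y i)) := by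
  rw [interleave, List.foldl_flatMap]
  -- Partial sums run over naturals with default `0` beyond the input, so that the invariant is
  -- defined for every natural index.
  have H := foldl_finRange_induction
    (fun s i => [x i, y i].foldl (parityStep c) s)
    (fun i s => ∃ t : Fin (m + m + 1), (t : ℕ) = i ∧ s = (t, none,
      ∑ l ∈ Finset.range i, (if h : l < m + m then ipTerm ⟨l, h⟩ (x ⟨l, h⟩) (y ⟨l, h⟩) else 0),
      fun j => ∑ l ∈ Finset.range i,
        (if h : l < m + m then parityTerm (c j) ⟨l, h⟩ (x ⟨l, h⟩) (y ⟨l, h⟩) else 0)))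
    ((0, none, 0, fun _ => 0) : ParityState k m) ⟨0, rfl, by simp⟩ ?_
  · obtain ⟨t, -, ht⟩ := H
    refine ⟨t, ht.trans ?_⟩
    simp only [Finset.sum_range, Fin.is_lt, dif_pos, Fin.eta]
  · rintro i s ⟨t, ht, rfl⟩
    have hti : (t : ℕ) < m + m := ht ▸ i.2
    refine ⟨t + 1, ?_, ?_⟩
    · rw [Fin.val_add_one_of_lt, ht]
      exact Fin.lt_def.2 hti
    · have hi : (⟨t, hti⟩ : Fin (m + m)) = i := Fin.ext ht
      simp only [List.foldl_cons, List.foldl_nil, parityStep, dif_pos hti, hi,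
        Finset.sum_range_succ, dif_pos i.2, Fin.eta]

lemma sum_ipTerm (x y : Fin (m + m) → Bool) :
    ∑ i, ipTerm i (x i) (y i) = ∑ i, bit (firstHalf x i && firstHalf y i) := by
  rw [Fin.sum_univ_add]
  simp [ipTerm, firstHalf]

lemma sum_parityTerm (ρ x y : Fin (m + m) → Bool) :
    ∑ i, parityTerm ρ i (x i) (y i) = parity ρ x + parity ρ (swapHalves y) := by
  simp only [parityTerm, Finset.sum_add_distrib, parity, swapHalves]
  congr 1
  rw [← Equiv.sum_comp (finAddFlip (m := m) (n := m)) fun l => bit (ρ l && y (finAddFlip l))]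
  refine Finset.sum_congr rfl fun i _ => ?_
  have h : finAddFlip (finAddFlip i) = i := by
    refine Fin.addCases (fun i => ?_) (fun i => ?_) i
    · rw [finAddFlip_apply_castAdd, finAddFlip_apply_natAdd]
    · rw [finAddFlip_apply_natAdd, finAddFlip_apply_castAdd]
  rw [h]

/-- The counter takes `Nat.log 2 (m + m) + 1` bits, the pending symbol 2, the inner product 1 and
the parities `k`. Coins are read afresh from `r` and occupy no memory. -/
theorem interleavedComplexity_ipEq_le {ε : ℝ} (hk : ((2 : ℝ≥0∞) ^ k)⁻¹ ≤ ENNReal.ofReal ε) :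
    interleavedComplexity (ipEq m) ε ≤ (Nat.log 2 (m + m) + (k + 4) : ℕ) := by
  refine interleavedComplexity_le (σ := ParityState k m) (k := k) (L := m + m) (ipEq m) ?_
    (0, none, 0, fun _ => 0) parityStep
    (fun s => decide (s.2.2.1 = 1) && decide (∀ j, s.2.2.2 j = 0)) fun x y => ?_
  · simp only [Fintype.card_prod, Fintype.card_fin, Fintype.card_option, Fintype.card_bool,
      Fintype.card_fun, ZMod.card]
    have h : m + m + 1 ≤ 2 ^ (Nat.log 2 (m + m) + 1) := Nat.lt_pow_succ_log_self (by norm_num) _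
    calc (m + m + 1) * ((2 + 1) * (2 * 2 ^ k))
        ≤ 2 ^ (Nat.log 2 (m + m) + 1) * (4 * (2 * 2 ^ k)) := by gcongr; norm_num
      _ = _ := by ring
  · refine le_trans ?_ hk
    have := measure_ne_ipEq_le k x y _ (ipEq_eq x y)
    refine le_trans (le_of_eq ?_) this
    congr 1
    ext r
    simp only [Set.mem_ofPred_eq]
    obtain ⟨t, ht⟩ := foldl_parityStep (coinTable k (m + m) r) x y
    -- In characteristic 2 the stored sums of parities are differences, so they vanish exactly when
    -- the parities agree.
    have h2 : ∀ a b : ZMod 2, a + b = 0 ↔ a = b := by decide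
    rw [ht, innerProduct_eq]
    simp only [sum_ipTerm, sum_parityTerm, h2]
    rfl

end Streaming

/-- Both upper bounds, with a common constant. -/
theorem complexity_ipEq_le {ε : ℝ} (hε : 0 < ε) : ∃ C : ℝ, ∀ m : ℕ, 1 ≤ m →
    (interleavedComplexity (ipEq m) ε : ℝ≥0∞) ≤
        ENNReal.ofReal (C * Real.log ((m + m : ℕ) : ℝ)) ∧
      (commComplexity (ipEq m) ε : ℝ≥0∞) ≤
        ENNReal.ofReal (C * Real.log ((m + m : ℕ) : ℝ)) := by
  obtain ⟨k, hk⟩ := exists_pow_lt_of_lt_one hε (show (1 / 2 : ℝ) < 1 by norm_num)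
  have hk' : ((2 : ℝ≥0∞) ^ k)⁻¹ ≤ ENNReal.ofReal ε := by
    have h : ENNReal.ofReal ((1 / 2 : ℝ) ^ k) = ((2 : ℝ≥0∞) ^ k)⁻¹ := by
      rw [ENNReal.ofReal_pow (by norm_num), one_div, ENNReal.ofReal_inv_of_pos (by norm_num),
        ENNReal.ofReal_ofNat, ENNReal.inv_pow]
    rw [← h]
    exact ENNReal.ofReal_le_ofReal hk.le
  -- One unit covers the rounded binary logarithm and `k + 4` the constant bits, as `log n / log 2 ≥
  -- 1` for `n ≥ 2`.
  refine ⟨(k + 5) / Real.log 2, fun m hm => ?_⟩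
  have hlog2 : 0 < Real.log 2 := Real.log_pos (by norm_num)
  have hq : 1 ≤ Real.log ((m + m : ℕ) : ℝ) / Real.log 2 := by
    rw [le_div_iff₀ hlog2, one_mul]
    refine Real.log_le_log (by norm_num) ?_
    exact_mod_cast (by omega : 2 ≤ m + m)
  have key : ∀ (a : ℕ∞) (n : ℕ), a ≤ n →
      (n : ℝ) ≤ (k + 5) / Real.log 2 * Real.log ((m + m : ℕ) : ℝ) →
      (a : ℝ≥0∞) ≤ ENNReal.ofReal ((k + 5) / Real.log 2 * Real.log ((m + m : ℕ) : ℝ)) := by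
    intro a n ha hn
    refine (ENat.toENNReal_le.2 ha).trans ?_
    rw [ENat.toENNReal_coe, ← ENNReal.ofReal_natCast]
    exact ENNReal.ofReal_le_ofReal hn
  have e : (k + 5) / Real.log 2 * Real.log ((m + m : ℕ) : ℝ) =
      Real.log ((m + m : ℕ) : ℝ) / Real.log 2 +
        (k + 4) * (Real.log ((m + m : ℕ) : ℝ) / Real.log 2) := by ring
  have hk4 : (k + 4 : ℝ) ≤ (k + 4) * (Real.log ((m + m : ℕ) : ℝ) / Real.log 2) :=
    le_mul_of_one_le_right (by positivity) hq
  refine ⟨key _ _ (interleavedComplexity_ipEq_le hk') ?_,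
    key _ _ (commComplexity_ipEq_le hk') ?_⟩
  · have hl := Real.natLog_le_logb (m + m) 2
    rw [Real.logb] at hl
    rw [e]
    push_cast at hl hk4 ⊢
    linarith
  · rw [e]
    push_cast at hq hk4 ⊢
    linarith

end StreamComm

theorem theorem2 (ε : ℝ) (hε0 : 0 < ε) (hε : ε < 1 / 2) :
    (∃ C : ℝ, ∀ m : ℕ, 1 ≤ m →
      (StreamComm.interleavedComplexity (StreamComm.ipEq m) ε : ℝ≥0∞) ≤
          ENNReal.ofReal (C * Real.log ((m + m : ℕ) : ℝ)) ∧
        (StreamComm.commComplexity (StreamComm.ipEq m) ε : ℝ≥0∞) ≤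
          ENNReal.ofReal (C * Real.log ((m + m : ℕ) : ℝ))) ∧
    ∀ c₀ : ℝ, 0 < c₀ → ∃ c : ℝ, 0 < c ∧
      ∀ (m S : ℕ) (P : StreamComm.SCProtocol S) (R : ℝ≥0),
        c₀ * Real.log ((m + m : ℕ) : ℝ) ≤ (S : ℝ) →
        P.Computes (StreamComm.ipEq m) ε → P.UsesRounds (m + m) R →
        c * ((m + m : ℕ) : ℝ) ≤ (R : ℝ) * (S : ℝ) := by
  exact ⟨StreamComm.complexity_ipEq_le hε0, fun _ hc₀ =>
    StreamComm.SCProtocol.rounds_mul_memory_ge hε0.le hε hc₀⟩
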